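/- Let $n\ge 0$ and let $\pi=\pi_1\pi_2\cdots\pi_n$ be a permutation of $\{1,\dots,n\}$ that avoids $231$, i.e. there are no $a<b<c$ with $\pi_c<\pi_a<\pi_b$. Let $s_i=(i,i+1)$ for $1\le i\le n-1$. A reduced word of $\pi$ is a word $i_1i_2\cdots i_k$ with $\pi=s_{i_1}s_{i_2}\cdots s_{i_k}$ and $k$ as small as possible. Let $G_\pi$ be the graph whose vertices are the reduced words of $\pi$, two of them being adjacent if one is obtained from the other by a single commutation move (adjacent letters $jk$ with $|j-k|>1$ are replaced by $kj$) or a single long braid move (consecutive letters $j(j+1)j$ are replaced by $(j+1)j(j+1)$, or vice versa). In $\mathbb R^n$ consider the hyperplanes $H_{ij}=\{x: x_i=x_j\}$, $1\le i<j\le n$, the chamber $c_0=\{x: x_1<x_2<\cdots<x_n\}$, and the chamber $\pi(c_0)$, where $\pi$ acts by permuting coordinates, $(\pi x)_{\pi_i}=x_i$. Let $L_2(\pi)$ be the set of all subspaces $X=H\cap K$, with $H\ne K$ two of these hyperplanes, such that every $H_{ij}$ containing $X$ separates $c_0$ from $\pi(c_0)$. (Equivalently, $|L_2(\pi)|$ is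 the number of unordered pairs of inversions of $\pi$ with no common index plus the number of $321$ patterns in $\pi$.) Then $G_\pi$ has finite diameter, and $$\operatorname{diam}(G_\pi)=|L_2(\pi)|.$$ -/

import Mathlib

/-! Permutations of `{1, …, n}` are elements of `Equiv.Perm (Fin n)`, so positions, values and
letters of words are counted from `0` instead of from `1`. Products of permutations are composed
from right to left. -/

namespace RedWord

/-- The simple reflection `s_i`, interchanging `i` and `i + 1`. The `n - 1` simple reflections
are indexed by `Fin (n - 1)`; there are none for `n = 0` and for `n = 1`. -/
def simpleRefl {n : ℕ} (i : Fin (n - 1)) : Equiv.Perm (Fin n) :=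
  Equiv.swap ⟨i.val, by omega⟩ ⟨i.val + 1, by omega⟩

/-- The permutation `s_{i₁} s_{i₂} ⋯ s_{i_k}` represented by the word `i₁ i₂ ⋯ i_k`. -/
def wordProd {n : ℕ} (w : List (Fin (n - 1))) : Equiv.Perm (Fin n) :=
  (w.map simpleRefl).prod

/-- `w` is a reduced word for `π`: it represents `π`, and it does so with the least number of
letters. -/
def IsReducedWord {n : ℕ} (π : Equiv.Perm (Fin n)) (w : List (Fin (n - 1))) : Prop :=
  wordProd w = π ∧ ∀ v : List (Fin (n - 1)), wordProd v = π → w.length ≤ v.length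

/-- A commutation move: two adjacent letters `j k` with `|j - k| > 1` are exchanged. -/
def CommMove {m : ℕ} (u v : List (Fin m)) : Prop :=
  ∃ (a b : List (Fin m)) (j k : Fin m), (j.val + 1 < k.val ∨ k.val + 1 < j.val) ∧
    u = a ++ [j, k] ++ b ∧ v = a ++ [k, j] ++ b

/-- A long braid move: consecutive letters `j k j` with `k = j + 1` or `j = k + 1` are replaced
by `k j k`. -/
def LongBraidMove {m : ℕ} (u v : List (Fin m)) : Prop :=
  ∃ (a b : List (Fin m)) (j k : Fin m), (k.val = j.val + 1 ∨ j.val = k.val + 1) ∧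
    u = a ++ [j, k, j] ++ b ∧ v = a ++ [k, j, k] ++ b

theorem CommMove.symm {m : ℕ} {u v : List (Fin m)} (h : CommMove u v) : CommMove v u := by
  obtain ⟨a, b, j, k, hjk, hu, hv⟩ := h
  exact ⟨a, b, k, j, hjk.symm, hv, hu⟩

theorem LongBraidMove.symm {m : ℕ} {u v : List (Fin m)} (h : LongBraidMove u v) :
    LongBraidMove v u := by
  obtain ⟨a, b, j, k, hjk, hu, hv⟩ := h
  exact ⟨a, b, k, j, hjk.symm, hv, hu⟩

theorem CommMove.ne {m : ℕ} {u v : List (Fin m)} (h : CommMove u v) : u ≠ v := by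
  obtain ⟨a, b, j, k, hjk, rfl, rfl⟩ := h
  intro h
  simp at h
  obtain ⟨rfl, -⟩ := h
  omega

theorem LongBraidMove.ne {m : ℕ} {u v : List (Fin m)} (h : LongBraidMove u v) : u ≠ v := by
  obtain ⟨a, b, j, k, hjk, rfl, rfl⟩ := h
  intro h
  simp at h
  obtain ⟨rfl, -⟩ := h
  omega

/-- The graph `G_π` on the set `R(π)` of reduced words for `π`: two reduced words are adjacent
when they differ by a single commutation move or a single long braid move. -/
def reducedWordGraph {n : ℕ} (π : Equiv.Perm (Fin n)) :
    SimpleGraph {w : List (Fin (n - 1)) // IsReducedWord π w} where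
  Adj u v := CommMove u.1 v.1 ∨ LongBraidMove u.1 v.1
  symm := ⟨fun _ _ h => h.imp CommMove.symm LongBraidMove.symm⟩
  loopless := ⟨fun _ h => h.elim (fun h => h.ne rfl) (fun h => h.ne rfl)⟩

/-- Two sequences of the same length are order isomorphic. -/
def OrderIsomorphic {k : ℕ} {α β : Type*} [LE α] [LE β] (u : Fin k → α) (v : Fin k → β) : Prop :=
  ∀ a b : Fin k, u a ≤ u b ↔ v a ≤ v b

/-- `π` contains the pattern `σ₁ σ₂ ⋯ σ_k`: some subsequence of `π₁ π₂ ⋯ π_n` is order isomorphic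
to it. -/
def ContainsPattern {n k : ℕ} (π : Equiv.Perm (Fin n)) (σ : Fin k → ℕ) : Prop :=
  ∃ f : Fin k → Fin n, StrictMono f ∧ OrderIsomorphic (fun a => π (f a)) σ

/-- `π` avoids the pattern `σ₁ σ₂ ⋯ σ_k`. -/
def AvoidsPattern {n k : ℕ} (π : Equiv.Perm (Fin n)) (σ : Fin k → ℕ) : Prop :=
  ¬ ContainsPattern π σ

/-! The reflection arrangement of type `A_{n-1}`, written in `ℝⁿ`. All its intersection subspaces
contain the line spanned by `(1, …, 1)`, and they correspond to those of the essential arrangement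
in the quotient of `ℝⁿ` by this line. -/

/-- The hyperplane `H_{ij} = {x | x_i = x_j}`. -/
def hyperplane {n : ℕ} (i j : Fin n) : Submodule ℝ (Fin n → ℝ) where
  carrier := {x | x i = x j}
  add_mem' := by
    intro x y hx hy
    change x i + y i = x j + y j
    rw [show x i = x j from hx, show y i = y j from hy]
  zero_mem' := rfl
  smul_mem' := by
    intro c x hx
    change c * x i = c * x j
    rw [show x i = x j from hx]

/-- The hyperplanes of the arrangement, `L_1 = {H_{ij} | i < j}`. -/
def arrangement (n : ℕ) : Set (Submodule ℝ (Fin n → ℝ)) :=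
  {H | ∃ i j : Fin n, i < j ∧ H = hyperplane i j}

/-- The set `L_2` of all codimension-two intersection subspaces of the arrangement. -/
def codimTwo (n : ℕ) : Set (Submodule ℝ (Fin n → ℝ)) :=
  {X | ∃ H ∈ arrangement n, ∃ K ∈ arrangement n, H ≠ K ∧ X = H ⊓ K}

/-- The base chamber `c₀ = {x | x₁ < x₂ < ⋯ < x_n}`. -/
def baseChamber (n : ℕ) : Set (Fin n → ℝ) := {x | StrictMono x}

/-- The chamber `π(c₀)`, where `π` acts on `ℝⁿ` by permuting coordinates:
`(π x)_{π(i)} = x_i`. -/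
def permChamber {n : ℕ} (π : Equiv.Perm (Fin n)) : Set (Fin n → ℝ) :=
  (fun x : Fin n → ℝ => fun i => x (π.symm i)) '' baseChamber n

/-- The hyperplane `H` separates `C` from `D`: the two sets lie strictly on opposite sides
of `H`. -/
def Separates {n : ℕ} (H : Submodule ℝ (Fin n → ℝ)) (C D : Set (Fin n → ℝ)) : Prop :=
  ∃ f : (Fin n → ℝ) →ₗ[ℝ] ℝ, LinearMap.ker f = H ∧ (∀ x ∈ C, f x < 0) ∧ ∀ y ∈ D, 0 < f y

/-- `L_1(π)`: the hyperplanes of the arrangement that separate `c₀` from `π(c₀)`. -/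
def sepHyperplanes {n : ℕ} (π : Equiv.Perm (Fin n)) : Set (Submodule ℝ (Fin n → ℝ)) :=
  {H | H ∈ arrangement n ∧ Separates H (baseChamber n) (permChamber π)}

/-- `L_2(π)`: the codimension-two intersection subspaces `X` such that every hyperplane of the
arrangement that contains `X` separates `c₀` from `π(c₀)`. -/
def sepCodimTwo {n : ℕ} (π : Equiv.Perm (Fin n)) : Set (Submodule ℝ (Fin n → ℝ)) :=
  {X | X ∈ codimTwo n ∧ ∀ H ∈ arrangement n, X ≤ H → H ∈ sepHyperplanes π}

end RedWord

/-! A reduced word of `π` builds the inversions of `π` one at a time, so its list `crossings 1 w` is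
an ordering of `inversions π`. Every element of `L_2(π)` singles out exactly one pair of inversions
related by `Precedes`: two disjoint inversions, compared by their larger values, or the outer two of
the three inversions of a `321` pattern (`ncard_sepCodimTwo`). For each such pair a word has one of
two orders; `upDefect` and `downDefect` count the two kinds, so they add up to `|L_2(π)|`.

A commutation move exchanges two disjoint neighbouring crossings, and a braid move reverses three
crossings on three values. Either way exactly one `Precedes` pair is flipped (`defects_comm`,
`defects_braid`), so `upDefect` changes by one along each edge.

The heart of the matter is that there are words `r` and `s` whose larger values weakly increase and
weakly decrease, respectively, and that every word `w` reaches `r` in `upDefect w` and `s` in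
`downDefect w` moves. Indeed, at a wrongly ordered neighbouring pair a defect-lowering move is
available (`exists_move_upDefect`, `exists_move_downDefect`); only the decreasing case needs
avoidance of `231`. Sorted words are unique (`IsReducedWord.eq_of_pairwise`).

Now `s` and `r` are at distance at least `|L_2(π)|`. Conversely, two words `u`, `v` can be joined
through `r` or through `s`; the two bounds have sum `2|L_2(π)|`, so one of them is at most
`|L_2(π)|`. -/

namespace RedWord

/-! ### Ordered pairs and sortedness in lists -/

/-- The number of pairs of entries of a list, `f` before `e`, with `R e f`. -/
def pairCount {α : Type*} (R : α → α → Prop) [DecidableRel R] : List α → ℕ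
  | [] => 0
  | f :: l => l.countP (fun e => R e f) + pairCount R l

section PairCount

variable {α : Type*} (R : α → α → Prop) [DecidableRel R]

/-- Only the relative order of `p` and `q` changes; adding the missing indicator on each side avoids
subtraction. -/
theorem pairCount_swap (A : List α) (p q : α) (B : List α) :
    pairCount R (A ++ p :: q :: B) + (if R p q then 1 else 0) =
      pairCount R (A ++ q :: p :: B) + (if R q p then 1 else 0) := by
  induction A with
  | nil =>
    simp only [List.nil_append, pairCount, List.countP_cons, decide_eq_true_eq]
    omega
  | cons a A ih =>
    have hperm : (A ++ p :: q :: B).Perm (A ++ q :: p :: B) :=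
      List.Perm.append_left A (List.Perm.swap q p B)
    simp only [List.cons_append, pairCount, hperm.countP_eq]
    omega

theorem pairCount_eq_zero {l : List α} (h : l.Pairwise fun f e => ¬ R e f) :
    pairCount R l = 0 := by
  induction l with
  | nil => rfl
  | cons f l ih =>
    rw [List.pairwise_cons] at h
    simp only [pairCount, ih h.2, Nat.add_zero, List.countP_eq_zero, decide_eq_true_eq]
    exact h.1

/-- Two distinct entries of a list without repetitions occur in exactly one of the two orders;
irreflexivity removes the diagonal. -/
theorem pairCount_add_pairCount_flip [DecidableEq α] (hR : ∀ a, ¬ R a a) {l : List α}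
    (hl : l.Nodup) :
    pairCount R l + pairCount (fun a b => R b a) l =
      ((l.toFinset ×ˢ l.toFinset).filter fun p => R p.1 p.2).card := by
  have key : ∀ s : Finset α, ((s ×ˢ s).filter fun p => R p.1 p.2).card =
      ∑ a ∈ s, ∑ b ∈ s, if R a b then 1 else 0 := by
    intro s
    rw [Finset.card_filter, Finset.sum_product]
  have count : ∀ (l : List α), l.Nodup → ∀ (p : α → Prop) [DecidablePred p],
      l.countP (fun a => p a) = ∑ a ∈ l.toFinset, if p a then 1 else 0 := by
    intro l hl p _
    rw [← Finset.card_filter, List.countP_eq_length_filter,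
      ← List.toFinset_card_of_nodup (hl.filter _), List.toFinset_filter]
    simp
  rw [key]
  induction l with
  | nil => rfl
  | cons f l ih =>
    rw [List.nodup_cons] at hl
    have hf : f ∉ l.toFinset := by simpa using hl.1
    have ih := ih hl.2
    rw [List.toFinset_cons, Finset.sum_insert hf, Finset.sum_insert hf, if_neg (hR f)]
    simp only [Finset.sum_insert hf, Finset.sum_add_distrib, pairCount]
    have h₁ := count l hl.2 (fun e => R e f)
    have h₂ := count l hl.2 (fun e => R f e)
    omega

end PairCount

/-- A list that is not sorted has a first descent. -/
theorem exists_first_failure {α : Type*} {r : α → α → Prop} [DecidableRel r] [IsTrans α r]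
    (l : List α) (h : ¬ l.Pairwise r) :
    ∃ A p q B, l = A ++ p :: q :: B ∧ ¬ r p q ∧ (A ++ [p]).Pairwise r := by
  induction l using List.reverseRecOn with
  | nil => exact absurd List.Pairwise.nil h
  | append_singleton l x ih =>
    by_cases hl : l.Pairwise r
    · rcases List.eq_nil_or_concat' l with rfl | ⟨A, p, rfl⟩
      · simp at h
      · refine ⟨A, p, x, [], by simp, fun hpx => h ?_, hl⟩
        rw [List.pairwise_append] at hl ⊢
        refine ⟨List.pairwise_append.2 hl, by simp, ?_⟩
        intro a ha b hb
        simp only [List.mem_singleton, List.mem_append] at ha hb hl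
        subst hb
        rcases ha with ha | rfl
        · exact _root_.trans (hl.2.2 a ha p rfl) hpx
        · exact hpx
    · obtain ⟨A, p, q, B, rfl, h₁, h₂⟩ := ih hl
      exact ⟨A, p, q, B ++ [x], by simp, h₁, h₂⟩

theorem exists_last_failure {α : Type*} {r : α → α → Prop} [DecidableRel r] [IsTrans α r]
    (l : List α) (h : ¬ l.Pairwise r) :
    ∃ A p q B, l = A ++ p :: q :: B ∧ ¬ r p q ∧ (q :: B).Pairwise r := by
  induction l with
  | nil => exact absurd List.Pairwise.nil h
  | cons x l ih =>
    by_cases hl : l.Pairwise r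
    · rcases l with _ | ⟨q, B⟩
      · simp at h
      · refine ⟨[], x, q, B, rfl, fun hxq => h ?_, hl⟩
        refine List.pairwise_cons.2 ⟨?_, hl⟩
        intro b hb
        rcases List.mem_cons.1 hb with rfl | hb
        · exact hxq
        · exact _root_.trans hxq ((List.pairwise_cons.1 hl).1 b hb)
    · obtain ⟨A, p, q, B, rfl, h₁, h₂⟩ := ih hl
      exact ⟨x :: A, p, q, B, rfl, h₁, h₂⟩

/-! ### Simple reflections and inversions -/

variable {n : ℕ}

/-- The left one of the two positions interchanged by `simpleRefl i`. -/
def lo (i : Fin (n - 1)) : Fin n := ⟨i.val, by omega⟩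

/-- The right one of the two positions interchanged by `simpleRefl i`. -/
def hi (i : Fin (n - 1)) : Fin n := ⟨i.val + 1, by omega⟩

theorem lo_lt_hi (i : Fin (n - 1)) : lo i < hi i := by simp [lo, hi, Fin.lt_def]

theorem lo_injective : Function.Injective (lo : Fin (n - 1) → Fin n) := by
  intro i j h; simpa [lo, Fin.ext_iff] using h

theorem hi_injective : Function.Injective (hi : Fin (n - 1) → Fin n) := by
  intro i j h; simpa [hi, Fin.ext_iff] using h

theorem simpleRefl_eq (i : Fin (n - 1)) : simpleRefl i = Equiv.swap (lo i) (hi i) := rfl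

@[simp] theorem simpleRefl_lo (i : Fin (n - 1)) : simpleRefl i (lo i) = hi i :=
  Equiv.swap_apply_left _ _

@[simp] theorem simpleRefl_hi (i : Fin (n - 1)) : simpleRefl i (hi i) = lo i :=
  Equiv.swap_apply_right _ _

theorem simpleRefl_of_ne {i : Fin (n - 1)} {x : Fin n} (h₁ : x ≠ lo i) (h₂ : x ≠ hi i) :
    simpleRefl i x = x := Equiv.swap_apply_of_ne_of_ne h₁ h₂

@[simp] theorem simpleRefl_mul_self (i : Fin (n - 1)) : simpleRefl i * simpleRefl i = 1 :=
  Equiv.swap_mul_self _ _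

@[simp] theorem wordProd_nil : wordProd ([] : List (Fin (n - 1))) = 1 := rfl

@[simp] theorem wordProd_cons (i : Fin (n - 1)) (w : List (Fin (n - 1))) :
    wordProd (i :: w) = simpleRefl i * wordProd w := by simp [wordProd]

@[simp] theorem wordProd_append (v w : List (Fin (n - 1))) :
    wordProd (v ++ w) = wordProd v * wordProd w := by simp [wordProd]

/-- The inversions of `σ`, as pairs of values `a < b` with `b` to the left of `a`. -/
def inversions (σ : Equiv.Perm (Fin n)) : Finset (Fin n × Fin n) :=
  Finset.univ.filter fun p => p.1 < p.2 ∧ σ.symm p.2 < σ.symm p.1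

theorem mem_inversions {σ : Equiv.Perm (Fin n)} {a b : Fin n} :
    (a, b) ∈ inversions σ ↔ a < b ∧ σ.symm b < σ.symm a := by simp [inversions]

theorem inversions_one : inversions (1 : Equiv.Perm (Fin n)) = ∅ := by
  ext ⟨a, b⟩
  simp only [mem_inversions, Finset.notMem_empty, iff_false, not_and, not_lt]
  exact fun h => h.le

theorem pair_notMem_inversions (σ : Equiv.Perm (Fin n)) (i : Fin (n - 1)) :
    (σ (lo i), σ (hi i)) ∉ inversions σ := by
  simp only [mem_inversions, Equiv.symm_apply_apply, not_and, not_lt]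
  exact fun _ => (lo_lt_hi i).le

theorem inversions_mul_simpleRefl {σ : Equiv.Perm (Fin n)} {i : Fin (n - 1)}
    (h : σ (lo i) < σ (hi i)) :
    inversions (σ * simpleRefl i) = insert (σ (lo i), σ (hi i)) (inversions σ) := by
  ext ⟨x, y⟩
  obtain ⟨p, rfl⟩ := σ.surjective x
  obtain ⟨q, rfl⟩ := σ.surjective y
  have hs : ∀ z, (σ * simpleRefl i).symm (σ z) = simpleRefl i z := by
    intro z
    rw [Equiv.symm_apply_eq, Equiv.Perm.mul_apply, ← Equiv.Perm.mul_apply (simpleRefl i)]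
    simp
  simp only [mem_inversions, Finset.mem_insert, Prod.mk.injEq, hs, Equiv.symm_apply_apply,
    σ.injective.eq_iff]
  have hv : ∀ z : Fin n, (simpleRefl i z).val =
      if z.val = i.val then i.val + 1 else if z.val = i.val + 1 then i.val else z.val := by
    intro z
    rw [simpleRefl_eq, Equiv.swap_apply_def]
    simp only [lo, hi, Fin.ext_iff]
    split_ifs <;> rfl
  rw [Fin.lt_def (a := simpleRefl i q), hv, hv, Fin.lt_def (a := q)]
  have hp : p = lo i ↔ p.val = i.val := by simp [lo, Fin.ext_iff]
  have hq : q = hi i ↔ q.val = i.val + 1 := by simp [hi, Fin.ext_iff]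
  have hp' : p = hi i ↔ p.val = i.val + 1 := by simp [hi, Fin.ext_iff]
  have hq' : q = lo i ↔ q.val = i.val := by simp [lo, Fin.ext_iff]
  rw [hp, hq]
  constructor
  · rintro ⟨h₁, h₂⟩
    by_cases hc : p.val = i.val ∧ q.val = i.val + 1
    · exact .inl hc
    · refine .inr ⟨h₁, ?_⟩
      split_ifs at h₂ <;> omega
  · rintro (⟨h₁, h₂⟩ | ⟨h₁, h₂⟩)
    · rw [hp.2 h₁, hq.2 h₂]
      refine ⟨h, ?_⟩
      simp [hi, lo]
    · refine ⟨h₁, ?_⟩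
      by_cases hc : q.val = i.val ∧ p.val = i.val + 1
      · rw [hp'.2 hc.2, hq'.2 hc.1] at h₁
        exact absurd h₁ h.not_gt
      · split_ifs <;> omega

/-! ### Crossings and reduced words -/

/-- The pairs of values interchanged by the successive letters of a word, starting at `σ`. -/
def crossings (σ : Equiv.Perm (Fin n)) : List (Fin (n - 1)) → List (Fin n × Fin n)
  | [] => []
  | i :: w => (σ (lo i), σ (hi i)) :: crossings (σ * simpleRefl i) w

theorem crossings_append (σ : Equiv.Perm (Fin n)) (v w : List (Fin (n - 1))) :
    crossings σ (v ++ w) = crossings σ v ++ crossings (σ * wordProd v) w := by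
  induction v generalizing σ with
  | nil => simp [crossings]
  | cons i v ih => simp [crossings, ih, mul_assoc]

/-- Every letter of the word, applied successively from `σ` on, creates an inversion. -/
def Ascending (σ : Equiv.Perm (Fin n)) (w : List (Fin (n - 1))) : Prop :=
  ∀ p ∈ crossings σ w, p.1 < p.2

theorem ascending_cons {σ : Equiv.Perm (Fin n)} {i : Fin (n - 1)} {w : List (Fin (n - 1))} :
    Ascending σ (i :: w) ↔ σ (lo i) < σ (hi i) ∧ Ascending (σ * simpleRefl i) w := by
  simp [Ascending, crossings]

theorem Ascending.inversions_eq {σ : Equiv.Perm (Fin n)} {w : List (Fin (n - 1))}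
    (h : Ascending σ w) :
    inversions (σ * wordProd w) = inversions σ ∪ (crossings σ w).toFinset := by
  induction w generalizing σ with
  | nil => simp [crossings]
  | cons i w ih =>
    rw [ascending_cons] at h
    rw [wordProd_cons, ← mul_assoc, ih h.2, inversions_mul_simpleRefl h.1]
    simp only [crossings, List.toFinset_cons, Finset.insert_union, Finset.union_insert]

/-- An ascending word never destroys an inversion, so no pair crosses twice. -/
theorem Ascending.nodup {σ : Equiv.Perm (Fin n)} {w : List (Fin (n - 1))} (h : Ascending σ w) :
    (crossings σ w).Nodup ∧ Disjoint (inversions σ) (crossings σ w).toFinset := by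
  induction w generalizing σ with
  | nil => simp [crossings]
  | cons i w ih =>
    rw [ascending_cons] at h
    obtain ⟨h₁, h₂⟩ := ih h.2
    rw [inversions_mul_simpleRefl h.1, Finset.disjoint_insert_left] at h₂
    refine ⟨List.nodup_cons.2 ⟨by simpa using h₂.1, h₁⟩, ?_⟩
    rw [crossings, List.toFinset_cons, Finset.disjoint_insert_right]
    exact ⟨pair_notMem_inversions σ i, h₂.2⟩

/-- Each letter changes the number of inversions by exactly one, up or down; equality leaves no room
for a descent. Hence length is the inversion number and reduced words are ascending. -/
theorem card_inversions_mul_le (σ : Equiv.Perm (Fin n)) (w : List (Fin (n - 1))) :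
    (inversions (σ * wordProd w)).card ≤ (inversions σ).card + w.length ∧
    ((inversions (σ * wordProd w)).card = (inversions σ).card + w.length → Ascending σ w) := by
  induction w generalizing σ with
  | nil => simp [Ascending, crossings]
  | cons i w ih =>
    obtain ⟨h₁, h₂⟩ := ih (σ * simpleRefl i)
    rw [wordProd_cons, ← mul_assoc, List.length_cons]
    rcases lt_or_gt_of_ne (σ.injective.ne (lo_lt_hi i).ne) with h | h
    · have hc : (inversions (σ * simpleRefl i)).card = (inversions σ).card + 1 := by
        rw [inversions_mul_simpleRefl h, Finset.card_insert_of_notMem (pair_notMem_inversions σ i)]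
      exact ⟨by omega, fun h' => ascending_cons.2 ⟨h, h₂ (by omega)⟩⟩
    · have hc : (inversions σ).card = (inversions (σ * simpleRefl i)).card + 1 := by
        have h' : (σ * simpleRefl i) (lo i) < (σ * simpleRefl i) (hi i) := by simpa using h
        have := inversions_mul_simpleRefl h'
        rw [mul_assoc, simpleRefl_mul_self, mul_one] at this
        rw [this, Finset.card_insert_of_notMem (pair_notMem_inversions _ i)]
      exact ⟨by omega, fun h' => by omega⟩

theorem exists_descent {σ : Equiv.Perm (Fin n)} (h : σ ≠ 1) :
    ∃ i : Fin (n - 1), σ (hi i) < σ (lo i) := by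
  by_contra! hc
  apply h
  rcases n with _ | n
  · exact Subsingleton.elim _ _
  have hmono : StrictMono σ := by
    rw [Fin.strictMono_iff_lt_succ]
    intro i
    exact lt_of_le_of_ne (hc i) (σ.injective.ne (lo_lt_hi (n := n + 1) i).ne)
  ext x
  have := hmono.range_inj (g := id) strictMono_id |>.1 (by simp [σ.surjective.range_eq])
  rw [this]; rfl

theorem exists_word (π : Equiv.Perm (Fin n)) :
    ∃ w, wordProd w = π ∧ w.length = (inversions π).card := by
  induction h : (inversions π).card generalizing π with
  | zero =>
    refine ⟨[], ?_, rfl⟩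
    by_contra hne
    obtain ⟨i, hi'⟩ := exists_descent (Ne.symm hne)
    rw [Finset.card_eq_zero] at h
    have : (π (hi i), π (lo i)) ∈ inversions π := mem_inversions.2 ⟨hi', by simpa using lo_lt_hi i⟩
    simp [h] at this
  | succ k ih =>
    have hne : π ≠ 1 := by rintro rfl; simp [inversions_one] at h
    obtain ⟨i, hi'⟩ := exists_descent hne
    have h' : (π * simpleRefl i) (lo i) < (π * simpleRefl i) (hi i) := by simpa using hi'
    have hc := inversions_mul_simpleRefl h'
    rw [mul_assoc, simpleRefl_mul_self, mul_one] at hc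
    rw [hc, Finset.card_insert_of_notMem (pair_notMem_inversions _ i)] at h
    obtain ⟨w, h₁, h₂⟩ := ih (π * simpleRefl i) (by omega)
    refine ⟨w ++ [i], ?_, by simp [h₂]⟩
    simp [h₁, mul_assoc]

theorem isReducedWord_iff_length {π : Equiv.Perm (Fin n)} {w : List (Fin (n - 1))} :
    IsReducedWord π w ↔ wordProd w = π ∧ w.length = (inversions π).card := by
  have hle : ∀ v : List (Fin (n - 1)), wordProd v = π → (inversions π).card ≤ v.length := by
    rintro v rfl
    have := (card_inversions_mul_le 1 v).1
    simpa [inversions_one] using this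
  constructor
  · rintro ⟨h₁, h₂⟩
    obtain ⟨v, h₃, h₄⟩ := exists_word π
    exact ⟨h₁, le_antisymm (h₄ ▸ h₂ v h₃) (hle w h₁)⟩
  · rintro ⟨h₁, h₂⟩
    exact ⟨h₁, fun v hv => h₂ ▸ hle v hv⟩

theorem IsReducedWord.ascending {π : Equiv.Perm (Fin n)} {w : List (Fin (n - 1))}
    (h : IsReducedWord π w) : Ascending 1 w := by
  rw [isReducedWord_iff_length] at h
  apply (card_inversions_mul_le 1 w).2
  simp [inversions_one, h.1, h.2]

theorem IsReducedWord.toFinset_crossings {π : Equiv.Perm (Fin n)} {w : List (Fin (n - 1))}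
    (h : IsReducedWord π w) : (crossings 1 w).toFinset = inversions π := by
  have := h.ascending.inversions_eq
  rw [one_mul, h.1, inversions_one, Finset.empty_union] at this
  exact this.symm

theorem IsReducedWord.of_eq {π : Equiv.Perm (Fin n)} {v w : List (Fin (n - 1))}
    (h : IsReducedWord π v) (h₁ : wordProd w = wordProd v) (h₂ : w.length = v.length) :
    IsReducedWord π w :=
  ⟨h₁.trans h.1, fun u hu => h₂ ▸ h.2 u hu⟩

/-! ### The two defects and the effect of moves on them -/

/-- For two inversions `e` and `f` of a permutation avoiding `231`, this says that they span an
element of `L_2(π)` for which `e` and `f` are the first and the last hyperplane, in the order by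
larger values. -/
def Precedes (e f : Fin n × Fin n) : Prop := e.2 < f.2 ∧ e.1 ≠ f.1

instance : DecidableRel (Precedes (n := n)) := fun e f =>
  inferInstanceAs (Decidable (e.2 < f.2 ∧ e.1 ≠ f.1))

/-- The number of pairs of crossings that occur against the order by larger values. -/
def upDefect (w : List (Fin (n - 1))) : ℕ := pairCount Precedes (crossings 1 w)

/-- The number of pairs of crossings that occur in the order by larger values. -/
def downDefect (w : List (Fin (n - 1))) : ℕ :=
  pairCount (fun e f => Precedes f e) (crossings 1 w)

theorem IsReducedWord.upDefect_add_downDefect {π : Equiv.Perm (Fin n)}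
    {w : List (Fin (n - 1))} (h : IsReducedWord π w) :
    upDefect w + downDefect w =
      ((inversions π ×ˢ inversions π).filter fun p => Precedes p.1 p.2).card := by
  rw [← h.toFinset_crossings]
  exact pairCount_add_pairCount_flip _ (fun _ h => absurd h.1 (lt_irrefl _)) h.ascending.nodup.1

theorem hi_eq_lo {j k : Fin (n - 1)} (h : k.val = j.val + 1) : hi j = lo k := by
  simp [lo, hi, h]

section Commutation

variable {j k : Fin (n - 1)} (h : j.val + 1 < k.val ∨ k.val + 1 < j.val)
include h

theorem far_ne : lo k ≠ lo j ∧ lo k ≠ hi j ∧ hi k ≠ lo j ∧ hi k ≠ hi j := by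
  simp only [lo, hi, ne_eq, Fin.mk.injEq]
  omega

theorem simpleRefl_comm : simpleRefl j * simpleRefl k = simpleRefl k * simpleRefl j := by
  obtain ⟨h₁, h₂, h₃, h₄⟩ := far_ne h
  ext x
  simp only [simpleRefl_eq, Equiv.Perm.mul_apply, Equiv.swap_apply_def]
  grind

theorem crossings_comm (σ : Equiv.Perm (Fin n)) (b : List (Fin (n - 1))) :
    crossings σ ([j, k] ++ b) = (σ (lo j), σ (hi j)) :: (σ (lo k), σ (hi k)) ::
      crossings (σ * wordProd [j, k]) b := by
  obtain ⟨h₁, h₂, h₃, h₄⟩ := far_ne h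
  simp [crossings, simpleRefl_of_ne h₁ h₂, simpleRefl_of_ne h₃ h₄, mul_assoc]

end Commutation

section Braid

variable {j k : Fin (n - 1)} (h : k.val = j.val + 1)
include h

theorem lo_ne_hi_of_succ : lo j ≠ hi k := by
  simp only [lo, hi, ne_eq, Fin.mk.injEq]
  omega

theorem simpleRefl_braid : simpleRefl j * (simpleRefl k * simpleRefl j) =
    simpleRefl k * (simpleRefl j * simpleRefl k) := by
  have h₁ := lo_ne_hi_of_succ h
  have h₂ := (lo_lt_hi j).ne
  have h₃ := (lo_lt_hi k).ne
  have h₄ := hi_eq_lo h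
  ext x
  simp only [simpleRefl_eq, Equiv.Perm.mul_apply, Equiv.swap_apply_def]
  grind

theorem crossings_pair_succ (σ : Equiv.Perm (Fin n)) (b : List (Fin (n - 1))) :
    crossings σ (j :: k :: b) = (σ (lo j), σ (hi j)) :: (σ (lo j), σ (hi k)) ::
      crossings (σ * simpleRefl j * simpleRefl k) b := by
  have h₁ : simpleRefl j (hi k) = hi k :=
    simpleRefl_of_ne (lo_ne_hi_of_succ h).symm (hi_eq_lo h ▸ (lo_lt_hi k).ne')
  simp [crossings, ← hi_eq_lo h, h₁]

theorem crossings_braid (σ : Equiv.Perm (Fin n)) (b : List (Fin (n - 1))) :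
    crossings σ ([j, k, j] ++ b) = (σ (lo j), σ (lo k)) :: (σ (lo j), σ (hi k)) ::
      (σ (lo k), σ (hi k)) :: crossings (σ * wordProd [j, k, j]) b := by
  have h₁ : simpleRefl k (lo j) = lo j :=
    simpleRefl_of_ne (hi_eq_lo h ▸ (lo_lt_hi j).ne) (lo_ne_hi_of_succ h)
  have h₂ : simpleRefl j (hi k) = hi k :=
    simpleRefl_of_ne (lo_ne_hi_of_succ h).symm (hi_eq_lo h ▸ (lo_lt_hi k).ne')
  have h₃ : simpleRefl j (lo k) = lo j := by rw [← hi_eq_lo h, simpleRefl_hi]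
  simp [crossings, hi_eq_lo h, h₁, h₂, h₃, mul_assoc]

theorem crossings_braid' (σ : Equiv.Perm (Fin n)) (b : List (Fin (n - 1))) :
    crossings σ ([k, j, k] ++ b) = (σ (lo k), σ (hi k)) :: (σ (lo j), σ (hi k)) ::
      (σ (lo j), σ (lo k)) :: crossings (σ * wordProd [j, k, j]) b := by
  have h₁ : simpleRefl k (lo j) = lo j :=
    simpleRefl_of_ne (hi_eq_lo h ▸ (lo_lt_hi j).ne) (lo_ne_hi_of_succ h)
  have h₂ : simpleRefl j (hi k) = hi k :=
    simpleRefl_of_ne (lo_ne_hi_of_succ h).symm (hi_eq_lo h ▸ (lo_lt_hi k).ne')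
  have h₃ : simpleRefl j (lo k) = lo j := by rw [← hi_eq_lo h, simpleRefl_hi]
  simp [crossings, hi_eq_lo h, h₁, h₂, h₃, mul_assoc, simpleRefl_braid h]

end Braid

theorem CommMove.wordProd_eq {u v : List (Fin (n - 1))} (h : CommMove u v) :
    wordProd v = wordProd u ∧ v.length = u.length := by
  obtain ⟨a, b, j, k, h, rfl, rfl⟩ := h
  simp [mul_assoc, ← mul_assoc (simpleRefl j), simpleRefl_comm h]

theorem LongBraidMove.wordProd_eq {u v : List (Fin (n - 1))} (h : LongBraidMove u v) :
    wordProd v = wordProd u ∧ v.length = u.length := by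
  obtain ⟨a, b, j, k, h, rfl, rfl⟩ := h
  refine ⟨?_, by simp⟩
  have : wordProd [k, j, k] = wordProd [j, k, j] := by
    rcases h with h | h <;> simp [simpleRefl_braid h]
  rw [wordProd_append, wordProd_append, wordProd_append, wordProd_append, this]

theorem pairCount_comm (R : Fin n × Fin n → Fin n × Fin n → Prop) [DecidableRel R]
    {j k : Fin (n - 1)} (h : j.val + 1 < k.val ∨ k.val + 1 < j.val) (a b : List (Fin (n - 1))) :
    pairCount R (crossings 1 (a ++ [j, k] ++ b)) +
        (if R (wordProd a (lo j), wordProd a (hi j)) (wordProd a (lo k), wordProd a (hi k))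
          then 1 else 0) =
      pairCount R (crossings 1 (a ++ [k, j] ++ b)) +
        (if R (wordProd a (lo k), wordProd a (hi k)) (wordProd a (lo j), wordProd a (hi j))
          then 1 else 0) := by
  rw [List.append_assoc, List.append_assoc, crossings_append 1 a, crossings_append 1 a, one_mul,
    crossings_comm h, crossings_comm h.symm]
  have : wordProd [k, j] = wordProd [j, k] := by simp [simpleRefl_comm h]
  rw [this]
  exact pairCount_swap R _ _ _ _

theorem defects_comm {j k : Fin (n - 1)} (h : j.val + 1 < k.val ∨ k.val + 1 < j.val)
    (a b : List (Fin (n - 1))) (hlt : wordProd a (hi k) < wordProd a (hi j)) :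
    upDefect (a ++ [j, k] ++ b) = upDefect (a ++ [k, j] ++ b) + 1 ∧
      downDefect (a ++ [j, k] ++ b) + 1 = downDefect (a ++ [k, j] ++ b) := by
  have h₁ : Precedes (wordProd a (lo k), wordProd a (hi k))
      (wordProd a (lo j), wordProd a (hi j)) :=
    ⟨hlt, (wordProd a).injective.ne (far_ne h).1⟩
  have h₂ : ¬ Precedes (wordProd a (lo j), wordProd a (hi j))
      (wordProd a (lo k), wordProd a (hi k)) := fun h' => hlt.not_gt h'.1
  have h₃ := pairCount_comm Precedes h a b
  have h₄ := pairCount_comm (fun e f => Precedes f e) h a b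
  rw [if_pos h₁, if_neg h₂] at h₃ h₄
  exact ⟨h₃, h₄⟩

/-- The reversal is three adjacent exchanges, of which only that of `p` and `r` can matter. -/
theorem pairCount_reverse_three {α : Type*} (R : α → α → Prop) [DecidableRel R] (A : List α)
    {p q r : α} (B : List α) (hpq : ¬ R p q) (hqp : ¬ R q p) (hqr : ¬ R q r) (hrq : ¬ R r q) :
    pairCount R (A ++ p :: q :: r :: B) + (if R p r then 1 else 0) =
      pairCount R (A ++ r :: q :: p :: B) + (if R r p then 1 else 0) := by
  have h₁ := pairCount_swap R A p q (r :: B)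
  have h₂ := pairCount_swap R (A ++ [q]) p r B
  have h₃ := pairCount_swap R A q r (p :: B)
  simp only [hpq, hqp, hqr, hrq, if_false, List.append_assoc, List.singleton_append] at h₁ h₂ h₃
  omega

/-- The middle crossing shares its smaller value with one neighbour and its larger value with the
other, so `Precedes` relates only the outer two. -/
theorem defects_braid {j k : Fin (n - 1)} (h : k.val = j.val + 1)
    (a b : List (Fin (n - 1))) (hlt : wordProd a (lo k) < wordProd a (hi k)) :
    upDefect (a ++ [k, j, k] ++ b) = upDefect (a ++ [j, k, j] ++ b) + 1 ∧
      downDefect (a ++ [k, j, k] ++ b) + 1 = downDefect (a ++ [j, k, j] ++ b) := by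
  simp only [upDefect, downDefect]
  rw [List.append_assoc, List.append_assoc, crossings_append 1 a, crossings_append 1 a, one_mul,
    crossings_braid h, crossings_braid' h]
  generalize wordProd a = σ at *
  have h₁ : Precedes (σ (lo j), σ (lo k)) (σ (lo k), σ (hi k)) :=
    ⟨hlt, σ.injective.ne (hi_eq_lo h ▸ (lo_lt_hi j).ne)⟩
  have h₂ : ¬ Precedes (σ (lo k), σ (hi k)) (σ (lo j), σ (lo k)) := fun h' => hlt.not_gt h'.1
  have h₃ := pairCount_reverse_three Precedes (crossings 1 a)
    (p := (σ (lo j), σ (lo k))) (q := (σ (lo j), σ (hi k))) (r := (σ (lo k), σ (hi k)))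
    (crossings (σ * wordProd [j, k, j]) b)
    (by simp [Precedes]) (by simp [Precedes]) (by simp [Precedes]) (by simp [Precedes])
  have h₄ := pairCount_reverse_three (fun e f => Precedes f e) (crossings 1 a)
    (p := (σ (lo j), σ (lo k))) (q := (σ (lo j), σ (hi k))) (r := (σ (lo k), σ (hi k)))
    (crossings (σ * wordProd [j, k, j]) b)
    (by simp [Precedes]) (by simp [Precedes]) (by simp [Precedes]) (by simp [Precedes])
  rw [if_pos h₁, if_neg h₂] at h₃ h₄
  exact ⟨by omega, by omega⟩

theorem upDefect_le_of_adj {u v : List (Fin (n - 1))} (hu : Ascending 1 u) (hv : Ascending 1 v)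
    (h : CommMove u v ∨ LongBraidMove u v) : upDefect u ≤ upDefect v + 1 := by
  rcases h with ⟨a, b, j, k, h, rfl, rfl⟩ | ⟨a, b, j, k, h, rfl, rfl⟩
  · rcases lt_or_gt_of_ne ((wordProd a).injective.ne (far_ne h).2.2.2) with hlt | hlt
    · exact (defects_comm h a b hlt).1.le
    · have := (defects_comm h.symm a b hlt).1
      omega
  -- The inequality required by `defects_braid` is read off from whichever word starts the braid
  -- with the larger letter.
  · have first : ∀ i w, Ascending 1 (a ++ i :: w) → wordProd a (lo i) < wordProd a (hi i) := by
      intro i w h'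
      apply h' (wordProd a (lo i), wordProd a (hi i))
      simp [crossings_append, crossings]
    rcases h with h | h
    · have := (defects_braid h a b (first k ([j, k] ++ b) (by simpa using hv))).1
      omega
    · exact (defects_braid h a b (first j ([k, j] ++ b) (by simpa using hu))).1.le

/-! ### Sorting the crossings by moves -/

theorem exists_of_crossings_eq_append {σ : Equiv.Perm (Fin n)} {w : List (Fin (n - 1))}
    {A L : List (Fin n × Fin n)} (h : crossings σ w = A ++ L) :
    ∃ a l, w = a ++ l ∧ crossings σ a = A ∧ crossings (σ * wordProd a) l = L := by
  induction A generalizing σ w with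
  | nil => exact ⟨[], w, rfl, rfl, by simpa using h⟩
  | cons p A ih =>
    rcases w with _ | ⟨i, w⟩
    · simp [crossings] at h
    · simp only [crossings, List.cons_append, List.cons.injEq] at h
      obtain ⟨a, l, rfl, h₁, h₂⟩ := ih h.2
      exact ⟨i :: a, l, rfl, by simp [crossings, h₁, h.1], by simpa [mul_assoc] using h₂⟩

theorem exists_of_crossings_eq_cons {σ : Equiv.Perm (Fin n)} {w : List (Fin (n - 1))}
    {p : Fin n × Fin n} {L : List (Fin n × Fin n)} (h : crossings σ w = p :: L) :
    ∃ i l, w = i :: l ∧ (σ (lo i), σ (hi i)) = p ∧ crossings (σ * simpleRefl i) l = L := by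
  rcases w with _ | ⟨i, w⟩
  · simp [crossings] at h
  · simp only [crossings, List.cons.injEq] at h
    exact ⟨i, w, rfl, h⟩

/-- A word moving only values smaller than `z` to the left fixes all positions from `z` on. -/
theorem wordProd_apply_of_crossings_lt {a : List (Fin (n - 1))} {z : Fin n}
    (h : ∀ p ∈ crossings 1 a, p.2 < z) {x : Fin n} (hx : z ≤ x) : wordProd a x = x := by
  induction a using List.reverseRecOn generalizing x with
  | nil => rfl
  | append_singleton a i ih =>
    rw [crossings_append, one_mul] at h
    have ih : ∀ {x}, z ≤ x → wordProd a x = x :=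
      ih fun p hp => h p (List.mem_append_left _ hp)
    have hlt : wordProd a (hi i) < z :=
      h (wordProd a (lo i), wordProd a (hi i)) (by simp [crossings])
    have hi_lt : hi i < z := by
      by_contra! hc
      rw [ih hc] at hlt
      exact hlt.not_ge hc
    have : simpleRefl i x = x :=
      simpleRefl_of_ne ((lo_lt_hi i).trans (hi_lt.trans_le hx)).ne' (hi_lt.trans_le hx).ne'
    simp [this, ih hx]

theorem Ascending.of_append_right {σ : Equiv.Perm (Fin n)} {a l : List (Fin (n - 1))}
    (h : Ascending σ (a ++ l)) : Ascending (σ * wordProd a) l := fun p hp =>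
  h p (by rw [crossings_append]; exact List.mem_append_right _ hp)

theorem letters_trichotomy (j k : Fin (n - 1)) :
    (j.val + 1 < k.val ∨ k.val + 1 < j.val) ∨ j = k ∨ k.val = j.val + 1 ∨ j.val = k.val + 1 := by
  rw [Fin.ext_iff]
  omega

theorem ascending_ne {σ : Equiv.Perm (Fin n)} {j k : Fin (n - 1)} {b : List (Fin (n - 1))}
    (h : Ascending σ (j :: k :: b)) : j ≠ k := by
  rintro rfl
  simp only [ascending_cons, Equiv.Perm.mul_apply, simpleRefl_lo, simpleRefl_hi] at h
  exact h.1.not_gt h.2.1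

/-- If the larger values of the crossings are not in increasing order, then some move lowers
`upDefect`. -/
theorem exists_move_upDefect {w : List (Fin (n - 1))} (hw : Ascending 1 w)
    (h : ¬ (crossings 1 w).Pairwise fun p q => p.2 ≤ q.2) :
    ∃ v, (CommMove w v ∨ LongBraidMove w v) ∧ upDefect w = upDefect v + 1 := by
  have : IsTrans (Fin n × Fin n) fun p q => p.2 ≤ q.2 := ⟨fun _ _ _ => le_trans⟩
  obtain ⟨A, p, q, B, hL, hpq, hA⟩ := exists_first_failure _ h
  obtain ⟨a, l, rfl, rfl, h₁⟩ := exists_of_crossings_eq_append hL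
  obtain ⟨j, l, rfl, rfl, h₂⟩ := exists_of_crossings_eq_cons h₁
  obtain ⟨k, b, rfl, rfl, -⟩ := exists_of_crossings_eq_cons h₂
  have hasc := hw.of_append_right
  rw [one_mul] at *
  simp only [not_le] at hpq
  rcases letters_trichotomy j k with hjk | rfl | hjk | hjk
  · refine ⟨a ++ [k, j] ++ b, .inl ⟨a, b, j, k, hjk, by simp, rfl⟩, ?_⟩
    obtain ⟨h₁, h₂, h₃, h₄⟩ := far_ne hjk
    have := (defects_comm hjk a b (by simpa [simpleRefl_of_ne h₃ h₄] using hpq)).1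
    simpa using this
  · exact absurd rfl (ascending_ne hasc)
  · have hjhik : simpleRefl j (hi k) = hi k :=
      simpleRefl_of_ne (lo_ne_hi_of_succ hjk).symm (hi_eq_lo hjk ▸ (lo_lt_hi k).ne')
    rw [Equiv.Perm.mul_apply, hjhik] at hpq
    -- Let `y` and `z < y` be the values at `hi j` and `hi k` after `a`. A letter leaves its larger
    -- value at its left position, so a last letter of `a` other than `k` has larger value different
    -- from `y`. By sortedness all larger values in `a` are then below `y`, so `a` fixes all
    -- positions from `y` on; thus `y` stands at place `y` and the next value exceeds it, contrary
    -- to `z < y`.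
    have hend : ∃ a', a = a' ++ [k] := by
      by_contra hne
      have hlt : ∀ p ∈ crossings 1 a, p.2 < wordProd a (hi j) := by
        rcases List.eq_nil_or_concat' a with rfl | ⟨a', m, rfl⟩
        · simp [crossings]
        · have hmk : m ≠ k := fun h => hne ⟨a', by rw [h]⟩
          rw [List.pairwise_append] at hA
          have hm : (wordProd (a' ++ [m])) (lo m) = wordProd a' (hi m) := by simp
          rw [crossings_append, one_mul] at hA ⊢
          have hle := hA.2.2 (wordProd a' (lo m), wordProd a' (hi m)) (by simp [crossings]) _
            (List.mem_singleton_self _)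
          have hlt : wordProd a' (hi m) < wordProd (a' ++ [m]) (hi j) := by
            refine lt_of_le_of_ne hle ?_
            rw [← hm, hi_eq_lo hjk]
            exact (Equiv.injective _).ne (lo_injective.ne hmk)
          intro p hp
          rcases List.mem_append.1 hp with hp' | hp'
          · refine lt_of_le_of_lt ?_ hlt
            exact (List.pairwise_append.1 hA.1).2.2 p hp' (wordProd a' (lo m), wordProd a' (hi m))
              (by simp [crossings])
          · simp only [crossings, List.mem_singleton] at hp'
            rw [hp']; exact hlt
      have hfix := fun x hx => wordProd_apply_of_crossings_lt hlt (x := x) hx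
      have hz : hi j = wordProd a (hi j) := (wordProd a).injective (hfix _ le_rfl).symm
      have hlt' : hi j < hi k := hi_eq_lo hjk ▸ lo_lt_hi k
      rw [hfix (hi k) (hz ▸ hlt'.le), ← hz] at hpq
      exact hpq.not_gt hlt'
    obtain ⟨a', rfl⟩ := hend
    refine ⟨a' ++ [j, k, j] ++ b, .inr ⟨a', b, k, j, .inr hjk, by simp, rfl⟩, ?_⟩
    have hk : wordProd a' (lo k) < wordProd a' (hi k) := by
      apply hw (wordProd a' (lo k), wordProd a' (hi k))
      simp [crossings_append, crossings]
    simpa using (defects_braid hjk a' b hk).1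
  -- Here both crossings have the same larger value, so there is no descent.
  · have hk : simpleRefl j (hi k) = hi j := by rw [hi_eq_lo hjk, simpleRefl_lo]
    simp [hk] at hpq

/-- If `π` avoids `231` and `(a, z)` is an inversion, then so is `(c, z)` for `a < c < z`. -/
theorem mem_inversions_of_avoids {π : Equiv.Perm (Fin n)} (hπ : AvoidsPattern π ![2, 3, 1])
    {a c z : Fin n} (h : (a, z) ∈ inversions π) (hac : a < c) (hcz : c < z) :
    (c, z) ∈ inversions π := by
  rw [mem_inversions] at h ⊢
  refine ⟨hcz, ?_⟩
  by_contra! hle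
  have hlt : π.symm c < π.symm z := lt_of_le_of_ne hle (π.symm.injective.ne hcz.ne)
  -- From left to right the values `c`, `z`, `a` would form a `231`.
  refine hπ ⟨![π.symm c, π.symm z, π.symm a], ?_, ?_⟩
  · intro x y hxy
    fin_cases x <;> fin_cases y <;> simp_all
    exact hlt.trans h.2
  · intro x y
    fin_cases x <;> fin_cases y <;> simp [hac.le, hcz.le, hac, hcz, h.1.le, h.1]

/-- If `π` avoids `231` and the larger values of the crossings are not in decreasing order, then
some move lowers `downDefect`. -/
theorem exists_move_downDefect {π : Equiv.Perm (Fin n)} (hπ : AvoidsPattern π ![2, 3, 1])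
    {w : List (Fin (n - 1))} (hw : IsReducedWord π w)
    (h : ¬ (crossings 1 w).Pairwise fun p q => q.2 ≤ p.2) :
    ∃ v, (CommMove w v ∨ LongBraidMove w v) ∧ downDefect w = downDefect v + 1 := by
  have : IsTrans (Fin n × Fin n) fun p q => q.2 ≤ p.2 := ⟨fun _ _ _ h h' => le_trans h' h⟩
  obtain ⟨A, p, q, B, hL, hpq, hB⟩ := exists_last_failure _ h
  obtain ⟨a, l, rfl, rfl, h₁⟩ := exists_of_crossings_eq_append hL
  obtain ⟨j, l, rfl, rfl, h₂⟩ := exists_of_crossings_eq_cons h₁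
  obtain ⟨k, b, rfl, rfl, hb⟩ := exists_of_crossings_eq_cons h₂
  have hasc := hw.ascending.of_append_right
  rw [one_mul] at *
  simp only [not_le] at hpq
  rcases letters_trichotomy j k with hjk | rfl | hjk | hjk
  · refine ⟨a ++ [k, j] ++ b, .inl ⟨a, b, j, k, hjk, by simp, rfl⟩, ?_⟩
    obtain ⟨h₁, h₂, h₃, h₄⟩ := far_ne hjk
    have := (defects_comm hjk.symm a b (by simpa [simpleRefl_of_ne h₃ h₄] using hpq)).2
    simpa using this.symm
  · exact absurd rfl (ascending_ne hasc)
  · set σ := wordProd a with hσ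
    set ρ := σ * simpleRefl j * simpleRefl k with hρ
    have hjhik : simpleRefl j (hi k) = hi k :=
      simpleRefl_of_ne (lo_ne_hi_of_succ hjk).symm (hi_eq_lo hjk ▸ (lo_lt_hi k).ne')
    have hkloj : simpleRefl k (lo j) = lo j :=
      simpleRefl_of_ne (hi_eq_lo hjk ▸ (lo_lt_hi j).ne) (lo_ne_hi_of_succ hjk)
    have hjlok : simpleRefl j (lo k) = lo j := by rw [← hi_eq_lo hjk, simpleRefl_hi]
    rw [Equiv.Perm.mul_apply, hjhik] at hpq
    have hloj : σ (lo j) < σ (hi j) := (ascending_cons.1 hasc).1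
    have hρj : ρ (hi j) = σ (hi k) := by
      rw [hρ, Equiv.Perm.mul_apply, Equiv.Perm.mul_apply, hi_eq_lo hjk, simpleRefl_lo, hjhik]
    have hρl : ρ (lo j) = σ (hi j) := by
      rw [hρ, Equiv.Perm.mul_apply, Equiv.Perm.mul_apply, hkloj, simpleRefl_lo]
    have hmem : (σ (lo j), σ (hi k)) ∈ inversions π := by
      rw [← hw.toFinset_crossings, List.mem_toFinset, crossings_append, one_mul,
        crossings_pair_succ hjk, ← hσ]
      simp
    have hcz := mem_inversions_of_avoids hπ hmem hloj hpq
    -- After `j k` these two values are adjacent and not yet inverted, so the remaining word `b`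
    -- must cross them.
    have hb' : (σ (hi j), σ (hi k)) ∈ crossings ρ b := by
      have hρb : Ascending ρ b := (ascending_cons.1 (ascending_cons.1 hasc).2).2
      have heq : ρ * wordProd b = π := by
        rw [← hw.1]; simp [hρ, hσ, mul_assoc]
      have := hρb.inversions_eq
      rw [heq] at this
      rw [this, Finset.mem_union, List.mem_toFinset] at hcz
      refine hcz.resolve_left fun hm => ?_
      rw [← hρj, ← hρl] at hm
      exact pair_notMem_inversions ρ j hm
    rcases b with _ | ⟨m, b⟩
    · simp [crossings] at hb'
    -- Larger values decrease from the second crossing on. A first letter of `b` other than `j`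
    -- would have larger value below `σ (hi k)`, and the pair in `hb'` could no longer cross.
    · have hmj : m = j := by
        by_contra hne
        rw [← hb, List.pairwise_cons] at hB
        have hle : ρ (hi m) ≤ σ (hi k) := by
          have : ρ (hi m) ≤ (σ * simpleRefl j) (hi k) :=
            hB.1 (ρ (lo m), ρ (hi m)) (by simp [crossings])
          rwa [Equiv.Perm.mul_apply σ _ (hi k), hjhik] at this
        have hlt : ρ (hi m) < σ (hi k) := by
          refine lt_of_le_of_ne hle ?_
          rw [← hρj]
          exact ρ.injective.ne (hi_injective.ne hne)
        rw [crossings, List.mem_cons] at hb'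
        rcases hb' with hb' | hb'
        · exact hlt.ne (Prod.mk.inj hb').2.symm
        · have := (List.pairwise_cons.1 hB.2).1 _ hb'
          exact this.not_gt hlt
      subst hmj
      refine ⟨a ++ [k, m, k] ++ b, .inr ⟨a, b, m, k, .inl hjk, by simp, rfl⟩, ?_⟩
      have := (defects_braid hjk a b (by rw [← hi_eq_lo hjk]; exact hpq)).2
      simpa using this.symm
  · have hk : simpleRefl j (hi k) = hi j := by rw [hi_eq_lo hjk, simpleRefl_lo]
    simp [hk] at hpq

/-- A word is determined by the larger values of its crossings. -/
theorem eq_of_map_snd_crossings_eq {σ : Equiv.Perm (Fin n)} {u v : List (Fin (n - 1))}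
    (h : (crossings σ u).map Prod.snd = (crossings σ v).map Prod.snd) : u = v := by
  induction u generalizing σ v with
  | nil =>
    rcases v with _ | ⟨j, v⟩
    · rfl
    · simp [crossings] at h
  | cons i u ih =>
    rcases v with _ | ⟨j, v⟩
    · simp [crossings] at h
    · simp only [crossings, List.map_cons, List.cons.injEq] at h
      -- The larger value sits at position `hi i` before the crossing, which reveals the letter.
      obtain rfl := hi_injective (σ.injective h.1)
      rw [ih h.2]

/-- Both crossing lists are orderings of the same inversions, so their sorted lists of larger values
agree. Ties are harmless because the larger values already determine the word. -/
theorem IsReducedWord.eq_of_pairwise {π : Equiv.Perm (Fin n)} {u v : List (Fin (n - 1))}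
    (hu : IsReducedWord π u) (hv : IsReducedWord π v) (r : Fin n → Fin n → Prop)
    [Std.Antisymm r]
    (h₁ : (crossings 1 u).Pairwise fun p q => r p.2 q.2)
    (h₂ : (crossings 1 v).Pairwise fun p q => r p.2 q.2) : u = v := by
  have hperm : (crossings 1 u).Perm (crossings 1 v) := by
    apply List.perm_of_nodup_nodup_toFinset_eq hu.ascending.nodup.1 hv.ascending.nodup.1
    rw [hu.toFinset_crossings, hv.toFinset_crossings]
  apply eq_of_map_snd_crossings_eq (σ := 1)
  exact (hperm.map Prod.snd).eq_of_pairwise' (List.pairwise_map.2 h₁) (List.pairwise_map.2 h₂)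

/-! ### Codimension-two subspaces and pairs of inversions -/

theorem mem_hyperplane {i j : Fin n} {x : Fin n → ℝ} : x ∈ hyperplane i j ↔ x i = x j := Iff.rfl

theorem separates_hyperplane_iff {π : Equiv.Perm (Fin n)} {i j : Fin n} (hij : i < j) :
    Separates (hyperplane i j) (baseChamber n) (permChamber π) ↔ (i, j) ∈ inversions π := by
  rw [mem_inversions]
  constructor
  · rintro ⟨f, hf, hC, hD⟩
    refine ⟨hij, ?_⟩
    by_contra! hle
    have hlt : π.symm i < π.symm j := lt_of_le_of_ne hle (π.symm.injective.ne hij.ne)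
    set p : Fin n → ℝ := fun x => (x.val : ℝ) with hp
    have hpC : p ∈ baseChamber n := fun x y hxy => by simpa [hp] using hxy
    set q : Fin n → ℝ := fun x => p (π.symm x) with hq
    have hqD : q ∈ permChamber π := ⟨p, hpC, rfl⟩
    have hpij : p i < p j := hpC hij
    have hqij : q i < q j := hpC hlt
    -- The coefficients are positive and make coordinates `i` and `j` agree, yet `f p < 0 < f q`
    -- forces a negative value of `f`.
    have hmem : (q j - q i) • p - (p j - p i) • q ∈ LinearMap.ker f := by
      rw [hf, mem_hyperplane]
      simp only [Pi.sub_apply, Pi.smul_apply, smul_eq_mul]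
      ring
    rw [LinearMap.mem_ker, map_sub, map_smul, map_smul, smul_eq_mul, smul_eq_mul] at hmem
    nlinarith [mul_pos (sub_pos.2 hpij) (hD q hqD),
      mul_neg_of_pos_of_neg (sub_pos.2 hqij) (hC p hpC)]
  · rintro ⟨-, hlt⟩
    refine ⟨(LinearMap.proj (R := ℝ) (φ := fun _ : Fin n => ℝ) i) - LinearMap.proj j, ?_, ?_, ?_⟩
    · ext x
      rw [LinearMap.mem_ker, mem_hyperplane]
      simp [sub_eq_zero]
    · intro x hx
      simpa using hx hij
    · rintro _ ⟨x, hx, rfl⟩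
      simpa using hx hlt

/-- The coordinates that agree on `H_{ab} ∩ H_{cd}`. -/
theorem inf_le_hyperplane_iff {a b c d i j : Fin n} (hab : a < b) (hcd : c < d) (hbd : b < d)
    (hac : a ≠ c) (hij : i < j) :
    hyperplane a b ⊓ hyperplane c d ≤ hyperplane i j ↔
      (i, j) = (a, b) ∨ (i, j) = (c, d) ∨ (b = c ∧ (i, j) = (a, d)) := by
  simp only [Prod.mk.injEq]
  constructor
  · intro h
    by_cases hbc : b = c
    -- A generic point of the intersection: glued coordinates get `-1`, all others their own index,
    -- which is nonnegative.
    · have := @h (fun x => if x = a ∨ x = b ∨ x = d then -1 else (x.val : ℝ))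
        (by simp [Submodule.mem_inf, mem_hyperplane, hbc])
      rw [mem_hyperplane] at this
      have hnn : ∀ x : Fin n, ((x.val : ℝ)) ≠ -1 := fun x => by
        have : (0 : ℝ) ≤ x.val := Nat.cast_nonneg _
        linarith
      split_ifs at this with h₁ h₂ h₂
      · omega
      · exact absurd this.symm (hnn j)
      · exact absurd this (hnn i)
      · have : i.val = j.val := by exact_mod_cast this
        omega
    -- With two disjoint blocks, `-1` and `-2` keep them apart from each other and from the
    -- remaining coordinates.
    · have := @h (fun x => if x = a ∨ x = b then -1 else if x = c ∨ x = d then -2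
          else (x.val : ℝ)) (by
            rw [Submodule.mem_inf, mem_hyperplane, mem_hyperplane]
            have h₁ : ¬ (c = a ∨ c = b) := by omega
            have h₂ : ¬ (d = a ∨ d = b) := by omega
            simp [h₁, h₂])
      rw [mem_hyperplane] at this
      have hnn : ∀ x : Fin n, ((x.val : ℝ)) ≠ -1 ∧ ((x.val : ℝ)) ≠ -2 := fun x => by
        have : (0 : ℝ) ≤ x.val := Nat.cast_nonneg _
        constructor <;> linarith
      split_ifs at this with h₁ h₂ h₂ h₂ h₂ h₂ h₂ h₂
      · omega
      · norm_num at this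
      · exact absurd this.symm (hnn j).1
      · norm_num at this
      · omega
      · exact absurd this.symm (hnn j).2
      · exact absurd this (hnn i).1
      · exact absurd this (hnn i).2
      · have : i.val = j.val := by exact_mod_cast this
        omega
  · rintro (⟨rfl, rfl⟩ | ⟨rfl, rfl⟩ | ⟨rfl, rfl, rfl⟩) x ⟨h₁, h₂⟩
    · exact h₁
    · exact h₂
    · exact Eq.trans h₁ h₂

theorem hyperplane_ne {a b c d : Fin n} (hab : a < b) (hcd : c < d) (hbd : b < d) :
    hyperplane a b ≠ hyperplane c d := by
  intro h
  have h₁ := (h.le : hyperplane a b ≤ hyperplane c d)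
    (x := fun x => if x = a ∨ x = b then -1 else (x.val : ℝ)) (by simp [mem_hyperplane])
  rw [mem_hyperplane] at h₁
  have hd : ¬ (d = a ∨ d = b) := by omega
  have hnn : ∀ x : Fin n, ((x.val : ℝ)) ≠ -1 := fun x => by
    have : (0 : ℝ) ≤ x.val := Nat.cast_nonneg _
    linarith
  simp only [if_neg hd] at h₁
  split_ifs at h₁
  · exact hnn d h₁.symm
  · have : c.val = d.val := by exact_mod_cast h₁
    omega

theorem mem_sepCodimTwo_of_precedes {π : Equiv.Perm (Fin n)} {a b c d : Fin n}
    (h₁ : (a, b) ∈ inversions π) (h₂ : (c, d) ∈ inversions π) (h : Precedes (a, b) (c, d)) :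
    hyperplane a b ⊓ hyperplane c d ∈ sepCodimTwo π := by
  have hab := (mem_inversions.1 h₁).1
  have hcd := (mem_inversions.1 h₂).1
  refine ⟨⟨_, ⟨a, b, hab, rfl⟩, _, ⟨c, d, hcd, rfl⟩, hyperplane_ne hab hcd h.1, rfl⟩, ?_⟩
  rintro _ ⟨i, j, hij, rfl⟩ hle
  refine ⟨⟨i, j, hij, rfl⟩, (separates_hyperplane_iff hij).2 ?_⟩
  rcases (inf_le_hyperplane_iff hab hcd h.1 h.2 hij).1 hle with h' | h' | ⟨rfl, h'⟩
  · rwa [h']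
  · rwa [h']
  · rw [h']
    exact mem_inversions.2 ⟨hab.trans hcd,
      (mem_inversions.1 h₂).2.trans (mem_inversions.1 h₁).2⟩

/-- The subspace determines the two or three hyperplanes containing it, and among these only one
ordered pair satisfies `Precedes`. -/
theorem inf_hyperplane_injective {a b c d a' b' c' d' : Fin n} (hab : a < b) (hcd : c < d)
    (hab' : a' < b') (hcd' : c' < d') (h : Precedes (a, b) (c, d))
    (h' : Precedes (a', b') (c', d'))
    (heq : hyperplane a b ⊓ hyperplane c d = hyperplane a' b' ⊓ hyperplane c' d') :
    a = a' ∧ b = b' ∧ c = c' ∧ d = d' := by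
  obtain ⟨hbd, hac⟩ := h
  obtain ⟨hbd', hac'⟩ := h'
  have key := fun i j hij => inf_le_hyperplane_iff (i := i) (j := j) hab hcd hbd hac hij
  have key' := fun i j hij => inf_le_hyperplane_iff (i := i) (j := j) hab' hcd' hbd' hac' hij
  rw [heq] at key
  have k₁ := (key' a b hab).1 ((key a b hab).2 (.inl rfl))
  have k₂ := (key' c d hcd).1 ((key c d hcd).2 (.inr (.inl rfl)))
  have k₃ := (key a' b' hab').1 ((key' a' b' hab').2 (.inl rfl))
  have k₄ := (key c' d' hcd').1 ((key' c' d' hcd').2 (.inr (.inl rfl)))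
  simp only [Prod.mk.injEq] at k₁ k₂ k₃ k₄ hbd hac hbd' hac'
  omega

/-- The intersection of two hyperplanes given by pairs with distinct larger entries is that of two
hyperplanes whose pairs also have distinct smaller entries. -/
theorem exists_precedes_of_lt {a b c d : Fin n} (hab : a < b) (hcd : c < d) (hbd : b < d) :
    ∃ a' b' c' d', a' < b' ∧ c' < d' ∧ Precedes (a', b') (c', d') ∧
      hyperplane a b ⊓ hyperplane c d = hyperplane a' b' ⊓ hyperplane c' d' := by
  by_cases hac : a = c
  · subst hac
    refine ⟨a, b, b, d, hab, hbd, ⟨hbd, hab.ne⟩, ?_⟩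
    ext x
    simp only [Submodule.mem_inf, mem_hyperplane]
    grind
  · exact ⟨a, b, c, d, hab, hcd, ⟨hbd, hac⟩, rfl⟩

theorem exists_precedes {a b c d : Fin n} (hab : a < b) (hcd : c < d)
    (hne : hyperplane a b ≠ hyperplane c d) :
    ∃ a' b' c' d', a' < b' ∧ c' < d' ∧ Precedes (a', b') (c', d') ∧
      hyperplane a b ⊓ hyperplane c d = hyperplane a' b' ⊓ hyperplane c' d' := by
  rcases lt_trichotomy b d with h | rfl | h
  · exact exists_precedes_of_lt hab hcd h
  · rcases lt_trichotomy a c with h | rfl | h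
    -- With a common larger entry, the subspace equates three coordinates; the outer two of its
    -- three hyperplanes have distinct smaller and distinct larger entries.
    · refine ⟨a, c, c, b, h, hcd, ⟨hcd, h.ne⟩, ?_⟩
      ext x
      simp only [Submodule.mem_inf, mem_hyperplane]
      grind
    · exact absurd rfl hne
    · refine ⟨c, a, a, b, h, hab, ⟨hab, h.ne⟩, ?_⟩
      ext x
      simp only [Submodule.mem_inf, mem_hyperplane]
      grind
  · rw [inf_comm]
    exact exists_precedes_of_lt hcd hab h

/-- `L_2(π)` is in bijection with the pairs of inversions related by `Precedes`. -/
theorem ncard_sepCodimTwo (π : Equiv.Perm (Fin n)) :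
    (sepCodimTwo π).ncard =
      ((inversions π ×ˢ inversions π).filter fun p => Precedes p.1 p.2).card := by
  rw [← Set.ncard_coe_finset]
  symm
  refine Set.ncard_congr (fun p _ => hyperplane p.1.1 p.1.2 ⊓ hyperplane p.2.1 p.2.2) ?_ ?_ ?_
  · rintro ⟨⟨a, b⟩, c, d⟩ h
    simp only [Finset.coe_filter, Finset.mem_product, Set.mem_ofPred_eq] at h
    exact mem_sepCodimTwo_of_precedes h.1.1 h.1.2 h.2
  · rintro ⟨⟨a, b⟩, c, d⟩ ⟨⟨a', b'⟩, c', d'⟩ h h' heq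
    simp only [Finset.coe_filter, Finset.mem_product, Set.mem_ofPred_eq, mem_inversions] at h h'
    obtain ⟨rfl, rfl, rfl, rfl⟩ := inf_hyperplane_injective h.1.1.1 h.1.2.1 h'.1.1.1 h'.1.2.1
      h.2 h'.2 heq
    rfl
  · rintro X ⟨⟨_, ⟨i, j, hij, rfl⟩, _, ⟨k, l, hkl, rfl⟩, hne, rfl⟩, hX⟩
    obtain ⟨a, b, c, d, hab, hcd, hp, heq⟩ := exists_precedes hij hkl hne
    rw [heq] at hX ⊢
    refine ⟨((a, b), (c, d)), ?_, rfl⟩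
    simp only [Finset.coe_filter, Finset.mem_product, Set.mem_ofPred_eq]
    exact ⟨⟨(separates_hyperplane_iff hab).1 (hX _ ⟨a, b, hab, rfl⟩ inf_le_left).2,
      (separates_hyperplane_iff hcd).1 (hX _ ⟨c, d, hcd, rfl⟩ inf_le_right).2⟩, hp⟩

/-! ### Distances in the graph and the diameter -/

theorem upDefect_eq_zero_of_pairwise {w : List (Fin (n - 1))}
    (h : (crossings 1 w).Pairwise fun p q => p.2 ≤ q.2) : upDefect w = 0 :=
  pairCount_eq_zero _ (h.imp fun h' h'' => h'.not_gt h''.1)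

theorem downDefect_eq_zero_of_pairwise {w : List (Fin (n - 1))}
    (h : (crossings 1 w).Pairwise fun p q => q.2 ≤ p.2) : downDefect w = 0 :=
  pairCount_eq_zero _ (h.imp fun h' h'' => h'.not_gt h''.1)

/-- If `D` can be lowered by a step at every vertex not satisfying `P`, and at most one vertex
satisfies `P`, then such a vertex exists and `D` bounds the distance to it. -/
theorem exists_edist_le_of_descent {V : Type*} (G : SimpleGraph V) [Nonempty V] (D : V → ℕ)
    (P : V → Prop) (hstep : ∀ v, ¬ P v → ∃ u, G.Adj v u ∧ D v = D u + 1)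
    (huniq : ∀ u v, P u → P v → u = v) : ∃ r, P r ∧ ∀ v, G.edist v r ≤ D v := by
  have key : ∀ k v, D v = k → ∃ r, P r ∧ G.edist v r ≤ D v := by
    intro k
    induction k with
    | zero =>
      intro v hv
      by_cases hP : P v
      · exact ⟨v, hP, by simp⟩
      · obtain ⟨u, -, h⟩ := hstep v hP
        omega
    | succ k ih =>
      intro v hv
      by_cases hP : P v
      · exact ⟨v, hP, by simp⟩
      · obtain ⟨u, hadj, h⟩ := hstep v hP
        obtain ⟨r, hr, hle⟩ := ih u (by omega)
        refine ⟨r, hr, (G.edist_triangle (v := u)).trans ?_⟩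
        rw [SimpleGraph.edist_eq_one_iff_adj.2 hadj, h, Nat.cast_add, Nat.cast_one, add_comm]
        gcongr
  obtain ⟨r, hr, -⟩ := key _ (Classical.arbitrary V) rfl
  refine ⟨r, hr, fun v => ?_⟩
  obtain ⟨r', hr', h⟩ := key _ v rfl
  rwa [huniq r r' hr hr']

theorem le_add_edist_of_adj {V : Type*} (G : SimpleGraph V) (D : V → ℕ)
    (hadj : ∀ u v, G.Adj u v → D u ≤ D v + 1) (u v : V) : (D u : ℕ∞) ≤ D v + G.edist u v := by
  by_cases hr : G.Reachable u v
  · obtain ⟨p, hp⟩ := hr.exists_walk_length_eq_edist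
    rw [← hp]
    norm_cast
    clear hp hr
    induction p with
    | nil => simp
    | cons h p ih =>
      have := hadj _ _ h
      rw [SimpleGraph.Walk.length_cons]
      omega
  · simp [SimpleGraph.edist_eq_top_of_not_reachable hr]

end RedWord

open RedWord in
theorem theorem6p6 {n : ℕ} (π : Equiv.Perm (Fin n))
    (hπ : RedWord.AvoidsPattern π ![2, 3, 1]) :
    (RedWord.reducedWordGraph π).ediam = ((RedWord.sepCodimTwo π).ncard : ℕ∞) := by
  have hne : Nonempty {w : List (Fin (n - 1)) // IsReducedWord π w} := by
    obtain ⟨w, h⟩ := exists_word π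
    exact ⟨⟨w, isReducedWord_iff_length.2 h⟩⟩
  have hsum : ∀ w : {w : List (Fin (n - 1)) // IsReducedWord π w},
      upDefect w.1 + downDefect w.1 = (sepCodimTwo π).ncard := fun w => by
    rw [w.2.upDefect_add_downDefect, ncard_sepCodimTwo]
  have hmove : ∀ {u : List (Fin (n - 1))}, IsReducedWord π u →
      ∀ {v}, CommMove u v ∨ LongBraidMove u v → IsReducedWord π v := by
    intro u hu v h
    have := h.elim CommMove.wordProd_eq LongBraidMove.wordProd_eq
    exact hu.of_eq this.1 this.2
  obtain ⟨r, hr, hup⟩ := exists_edist_le_of_descent (reducedWordGraph π)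
    (fun w => upDefect w.1) (fun w => (crossings 1 w.1).Pairwise fun p q => p.2 ≤ q.2)
    (fun w h => by
      obtain ⟨v, hv, hD⟩ := exists_move_upDefect w.2.ascending h
      exact ⟨⟨v, hmove w.2 hv⟩, hv, hD⟩)
    (fun u v hu hv => Subtype.ext (u.2.eq_of_pairwise v.2 (· ≤ ·) hu hv))
  obtain ⟨s, hs, hdown⟩ := exists_edist_le_of_descent (reducedWordGraph π)
    (fun w => downDefect w.1) (fun w => (crossings 1 w.1).Pairwise fun p q => q.2 ≤ p.2)
    (fun w h => by
      obtain ⟨v, hv, hD⟩ := exists_move_downDefect hπ w.2 h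
      exact ⟨⟨v, hmove w.2 hv⟩, hv, hD⟩)
    (fun u v hu hv => Subtype.ext (u.2.eq_of_pairwise v.2 (· ≥ ·) hu hv))
  apply le_antisymm
  · apply SimpleGraph.ediam_le_of_edist_le
    intro u v
    have hu := hsum u
    have hv := hsum v
    -- If the route through `r` is too long, the one through `s` is short enough, since the four
    -- defects sum to `2|L_2(π)|`.
    rcases le_total (upDefect u.1 + upDefect v.1) (sepCodimTwo π).ncard with h | h
    · calc (reducedWordGraph π).edist u v
          ≤ (reducedWordGraph π).edist u r + (reducedWordGraph π).edist r v :=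
            SimpleGraph.edist_triangle
        _ ≤ upDefect u.1 + upDefect v.1 :=
            add_le_add (hup u) (SimpleGraph.edist_comm.trans_le (hup v))
        _ ≤ _ := by exact_mod_cast h
    · calc (reducedWordGraph π).edist u v
          ≤ (reducedWordGraph π).edist u s + (reducedWordGraph π).edist s v :=
            SimpleGraph.edist_triangle
        _ ≤ downDefect u.1 + downDefect v.1 :=
            add_le_add (hdown u) (SimpleGraph.edist_comm.trans_le (hdown v))
        _ ≤ _ := by
          have : downDefect u.1 + downDefect v.1 ≤ (sepCodimTwo π).ncard := by omega
          exact_mod_cast this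
  -- The two sorted words attain the bound: `upDefect` is `|L_2(π)|` at `s` and `0` at `r`.
  · have h := le_add_edist_of_adj (reducedWordGraph π) (fun w => upDefect w.1)
      (fun u v h => upDefect_le_of_adj u.2.ascending v.2.ascending h) s r
    have h₁ := hsum s
    rw [downDefect_eq_zero_of_pairwise hs, add_zero] at h₁
    rw [upDefect_eq_zero_of_pairwise hr, h₁, Nat.cast_zero, zero_add] at h
    exact h.trans SimpleGraph.edist_le_ediam
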